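/- A group \(T\) is called telescopic if for every finite group \(\Gamma\) there is a finite-index subgroup \(H \le T\) with \(N_T(H)/H \cong \Gamma\), where \(N_T(H)\) is the normaliser of \(H\) in \(T\); it is called freely telescopic if \(H\) can always be chosen to be, in addition, a free group. Let \(T = G_1 * \cdots * G_n\) be a free product of finitely many, \(n \ge 2\), non-trivial (finite or infinite) cyclic groups, other than \(\mathbb{Z}_2 * \mathbb{Z}_2\) (that is, it is not the case that \(n = 2\) and \(G_1\), \(G_2\) both have order \(2\)). Then \(T\) is freely telescopic. The group \(\mathbb{Z}_2 * \mathbb{Z}_2\) is not telescopic. -/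

import Mathlib

universe w u v

/-- A group `T` is telescopic if for every finite group `Γ` there is a finite-index subgroup
`H ≤ T` with `N_T(H) / H ≅ Γ`. -/
def IsTelescopic (T : Type u) [Group T] : Prop :=
  ∀ (Γ : Type w) [Group Γ] [Finite Γ], ∃ H : Subgroup T, H.FiniteIndex ∧
    Nonempty ((↥(Subgroup.normalizer (H : Set T)) ⧸
      H.subgroupOf (Subgroup.normalizer (H : Set T))) ≃* Γ)

/-- A group `T` is freely telescopic if for every finite group `Γ` there is a finite-index
subgroup `H ≤ T` that is a free group and satisfies `N_T(H) / H ≅ Γ`. -/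
def IsFreelyTelescopic (T : Type u) [Group T] : Prop :=
  ∀ (Γ : Type w) [Group Γ] [Finite Γ], ∃ H : Subgroup T, H.FiniteIndex ∧ IsFreeGroup H ∧
    Nonempty ((↥(Subgroup.normalizer (H : Set T)) ⧸
      H.subgroupOf (Subgroup.normalizer (H : Set T))) ≃* Γ)

/-! Suppose `T` maps onto `P * Q` with `P`, `Q` finite, every non-free factor embedding in `P` or
`Q`, and pick `α` in `P` with `α² ≠ 1` and `β ≠ 1` in `Q`. On `P × Q × ZMod n × Γ` let `P` act by
left multiplication on the first coordinate and `Q` by left multiplication on the second, conjugated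
by a permutation `φ` commuting with right multiplication by `Γ`. A suitable `φ` makes the action
transitive and `β⁻¹α` fix exactly the points `(1, 1, 0, γ)` (`exists_equivariant_action`).

Let `H` be the stabilizer of `(1, 1, 0, 1)`. It contains a lift of `β⁻¹α`, so it fixes no points
other than the `(1, 1, 0, γ)`. As `Γ` permutes these simply transitively by automorphisms of the
`T`-set, `N(H)/H ≅ Γ`. Non-free factors act freely, so their conjugates meet `H` trivially, and `H`
is free by Kurosh (`Subgroup.isFreeGroup_of_coprodI`).

In a group generated by two involutions, `N(H)/H` never has order 3: either `H` contains a
reflection and the quotient has exponent dividing 2, or `H` is normal and the quotient is generated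
by elements of square 1. -/

/-! ### Free action groupoids and a Kurosh theorem -/

/-- A cocycle on the action groupoid of `G` on `X` with values in `M`. -/
def IsActionCocycle {G X M : Type*} [Group G] [MulAction G X] [Group M] (c : G → X → M) : Prop :=
  ∀ g h x, c (g * h) x = c g (h • x) * c h x

/-- `S` is a set of arrows of the action groupoid of `G` on `X` that freely generates it, as
tested on functors to groups in a given universe. -/
def IsActionBasis {G : Type u} {X : Type v} [Group G] [MulAction G X] (S : Set (G × X)) : Prop :=
  ∀ (M : Type w) [Group M] (f : G → X → M),
    ∃! c : G → X → M, IsActionCocycle c ∧ ∀ g x, (g, x) ∈ S → c g x = f g x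

section

variable {G : Type u} {X : Type v} {M : Type*} [Group G] [MulAction G X] [Group M]

theorem IsActionCocycle.one {c : G → X → M} (hc : IsActionCocycle c) (x : X) : c 1 x = 1 := by
  have := hc 1 1 x
  rw [mul_one, one_smul] at this
  exact left_eq_mul.mp this

/-- A cocycle with values in `M`, as a homomorphism to a semidirect product, where the action
of `G` is pulled back from that of `T`. -/
def IsActionCocycle.toSemidirect {T : Type*} [Group T] [MulAction T X] (j : G →* T)
    (hj : ∀ g (x : X), j g • x = g • x) {c : G → X → M} (hc : IsActionCocycle c) :
    G →* (X → M) ⋊[mulAutArrow] T where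
  toFun g := ⟨fun b => c g (g⁻¹ • b), j g⟩
  map_one' := by
    ext b
    · simp [hc.one]
    · simp
  map_mul' g h := by
    ext b
    · change c (g * h) ((g * h)⁻¹ • b) = c g (g⁻¹ • b) * c h (h⁻¹ • (j g)⁻¹ • b)
      rw [hc, ← map_inv, hj, mul_inv_rev, mul_smul, smul_inv_smul]
    · simp

/-- The action groupoid of a free action is an equivalence relation, so the arrows from a chosen
point of each orbit to the other points form a spanning star. Every cocycle is then a coboundary `F
(g • x) * (F x)⁻¹`, with `F` read off along the star. -/
theorem IsActionBasis.of_free (hfree : ∀ (g : G) (x : X), g • x = x → g = 1) :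
    ∃ S : Set (G × X), IsActionBasis.{w} S := by
  classical
  obtain ⟨rep, hrep⟩ : ∃ rep : X → X, ∀ x, (∃ g : G, g • rep x = x) ∧
      ∀ g : G, rep (g • x) = rep x := by
    let s := MulAction.orbitRel G X
    refine ⟨fun x => (Quotient.mk s x).out, fun x => ⟨?_, fun g => ?_⟩⟩
    · have h : s x (Quotient.mk s x).out := s.symm (Quotient.mk_out (s := s) x)
      exact h
    · have : Quotient.mk s (g • x) = Quotient.mk s x := Quotient.sound ⟨g, rfl⟩
      simp only [this]
  choose t ht using fun x => (hrep x).1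
  have cancel : ∀ (g h : G) (x : X), g • x = h • x → g = h := fun g h x e => by
    have : h⁻¹ * g = 1 := hfree _ x (by rw [mul_smul, e, inv_smul_smul])
    exact (inv_mul_eq_one.mp this).symm
  have ht_mul : ∀ g x, t (g • x) = g * t x := fun g x => by
    refine cancel _ _ (rep x) ?_
    rw [mul_smul, ht x]
    simpa only [(hrep x).2 g] using ht (g • x)
  have ht_one : ∀ x, t x = 1 → rep x = x := fun x h => by
    simpa [h] using ht x
  have t_rep : ∀ x, t (rep x) = 1 := fun x => by
    have h := ht_mul (t x) (rep x)
    rw [ht x] at h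
    exact left_eq_mul.mp h
  have rep_rep : ∀ x, rep (rep x) = rep x := fun x => ht_one _ (t_rep x)
  refine ⟨{p | t p.2 = 1 ∧ p.1 ≠ 1}, fun M _ f => ?_⟩
  let F : X → M := fun x => if t x = 1 then 1 else f (t x) (rep x)
  refine ⟨fun g x => F (g • x) * (F x)⁻¹, ⟨fun g h x => ?_, ?_⟩, ?_⟩
  · simp [mul_smul]
  · rintro g x ⟨h1, h2⟩
    simp only at h1 h2
    simp [F, h1, ht_mul, h2, (hrep x).2, ht_one x h1]
  · rintro c ⟨hc, hcS⟩
    have key : ∀ x, c (t x) (rep x) = F x := fun x => by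
      by_cases h : t x = 1
      · simp [F, h, hc.one]
      · simp only [F, h, if_false]
        exact hcS _ _ ⟨t_rep x, h⟩
    funext g x
    have h := hc g (t x) (rep x)
    rw [ht x, key x] at h
    have h' := key (g • x)
    rw [ht_mul, (hrep x).2, h] at h'
    rw [← h', mul_inv_cancel_right]

/-- Cocycles are the homomorphisms to the wreath product that lift the identity of `G`, so they are
determined freely by their values on the generators. -/
theorem IsActionBasis.of_isFreeGroup [IsFreeGroup G] :
    ∃ S : Set (G × X), IsActionBasis.{w} S := by
  refine ⟨{p | ∃ e : IsFreeGroup.Generators G, p.1 = IsFreeGroup.of e}, fun M _ f => ?_⟩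
  obtain ⟨F, hF, uF⟩ := IsFreeGroup.unique_lift
    (fun e : IsFreeGroup.Generators G => (⟨fun b => f (IsFreeGroup.of e)
      ((IsFreeGroup.of e)⁻¹ • b), IsFreeGroup.of e⟩ : (X → M) ⋊[mulAutArrow] G))
  have hright : ∀ g, (F g).right = g := by
    have : SemidirectProduct.rightHom.comp F = MonoidHom.id G :=
      IsFreeGroup.ext_hom fun e => by simp [hF]
    exact fun g => DFunLike.congr_fun this g
  refine ⟨fun g x => (F g).left (g • x), ⟨fun g h x => ?_, ?_⟩, ?_⟩
  · simp only [map_mul, SemidirectProduct.mul_left, Pi.mul_apply, hright, mul_smul]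
    congr 1
    change (F h).left (g⁻¹ • g • h • x) = _
    rw [inv_smul_smul]
  · rintro g x ⟨e, he⟩
    simp only at he
    subst he
    simp [hF]
  · rintro c ⟨hc, hcS⟩
    have : hc.toSemidirect (MonoidHom.id G) (fun _ _ => rfl) = F := uF _ fun e => by
      ext b
      · exact hcS _ _ ⟨e, rfl⟩
      · rfl
    funext g x
    rw [← this]
    change _ = c g (g⁻¹ • g • x)
    rw [inv_smul_smul]

end

open CategoryTheory ActionCategory Monoid in
/-- The action groupoid of a free product is free if those of the factors are. -/
theorem nonempty_isFreeGroupoid_actionCategory {ι : Type u} {G : ι → Type v} [∀ i, Group (G i)]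
    {X : Type max u v} [MulAction (CoprodI G) X] [∀ i, MulAction (G i) X]
    (hof : ∀ i (g : G i) (x : X), (CoprodI.of g : CoprodI G) • x = g • x)
    (hS : ∀ i, ∃ S : Set (G i × X), IsActionBasis.{max u v} S) :
    Nonempty (IsFreeGroupoid (ActionCategory (CoprodI G) X)) := by
  choose S hS using hS
  refine ⟨
    { quiverGenerators := ⟨fun a b => { e : Σ i, G i // (e.2, a.back) ∈ S e.1 ∧
        (CoprodI.of e.2 : CoprodI G) • a.back = b.back }⟩
      of := fun (e : Subtype _) => ⟨CoprodI.of e.1.2, e.2.2⟩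
      unique_lift := ?_ }⟩
  intro M _ f
  classical
  -- The value 1 off `S i` is arbitrary: a basis constrains cocycles only on `S i`.
  let f' : ∀ i, G i → X → M := fun i g x => if h : (g, x) ∈ S i then
    @f ⟨(), x⟩ ⟨(), (CoprodI.of g : CoprodI G) • x⟩ ⟨⟨i, g⟩, h, rfl⟩ else 1
  choose c hc uc using fun i => hS i M (f' i)
  let F' : CoprodI G →* (X → M) ⋊[mulAutArrow] CoprodI G :=
    CoprodI.lift fun i => (hc i).1.toSemidirect CoprodI.of (hof i)
  have hF' : ∀ i (g : G i), F' (CoprodI.of g) = ⟨fun b => c i g (g⁻¹ • b), CoprodI.of g⟩ :=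
    fun i g => CoprodI.lift_of _ g
  refine ⟨uncurry F' ?_, ?_, ?_⟩
  · suffices SemidirectProduct.rightHom.comp F' = MonoidHom.id _ from DFunLike.ext_iff.mp this
    refine CoprodI.ext_hom _ _ fun i => ?_
    ext g
    simp [hF']
  · rintro ⟨⟨⟩, a : X⟩ ⟨⟨⟩, b : X⟩ ⟨⟨i, g⟩, h1 : (g, a) ∈ S i, h : CoprodI.of g • a = b⟩
    change (F' (CoprodI.of g)).left b = _
    subst h
    rw [hF']
    change c i g (g⁻¹ • _) = _
    have h2 : g⁻¹ • (CoprodI.of g : CoprodI G) • a = a := by rw [hof, inv_smul_smul]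
    refine ((congrArg (c i g) h2).trans ((hc i).2 g a h1)).trans ?_
    exact dif_pos h1
  · intro E hE
    have hmap : ∀ ⦃a b : ActionCategory (CoprodI G) X⦄ (p : a ⟶ b),
        @Eq M (E.map p) ((curry E p.val).left b.back) :=
      ActionCategory.cases fun t g => rfl
    have hmul : ∀ (s t : CoprodI G) (x : X), (curry E (s * t)).left x =
        (curry E s).left x * (curry E t).left (s⁻¹ • x) := fun s t x => by
      rw [map_mul]
      rfl
    have : curry E = F' := by
      refine CoprodI.ext_hom _ _ fun i => ?_
      have hd : (fun g x => (curry E (CoprodI.of g)).left ((CoprodI.of g : CoprodI G) • x)) =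
          c i := by
        refine uc i _ ⟨fun g h x => ?_, fun g x hx => ?_⟩
        · simp only [map_mul CoprodI.of, hmul, mul_smul, inv_smul_smul, hof i h]
        · have h1 := hE ⟨(), x⟩ ⟨(), (CoprodI.of g : CoprodI G) • x⟩ ⟨⟨i, g⟩, hx, rfl⟩
          have h2 : f' i g x = _ := dif_pos hx
          rw [h2]
          exact (hmap _).symm.trans h1
      refine MonoidHom.ext fun g => ?_
      change curry E (CoprodI.of g) = F' (CoprodI.of g)
      rw [hF', ← hd]
      refine SemidirectProduct.ext ?_ rfl
      funext b
      change _ = (curry E (CoprodI.of g)).left ((CoprodI.of g : CoprodI G) • g⁻¹ • b)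
      rw [hof, smul_inv_smul]
    apply Functor.hext
    · intro
      apply Unit.ext
    · intro a b p
      refine heq_of_eq ((hmap p).trans ?_)
      rw [this]
      rfl

-- `H` is the vertex group at the coset of 1, and a vertex group of a connected free groupoid is
-- free.
open CategoryTheory ActionCategory in
theorem Subgroup.isFreeGroup_of_isFreeGroupoid {T : Type u} [Group T] (H : Subgroup T)
    [IsFreeGroupoid (ActionCategory T (T ⧸ H))] : IsFreeGroup H := by
  have h1 : @CategoryTheory.IsConnected (ActionCategory T (T ⧸ H)) Groupoid.toCategory :=
    have : Nonempty (ActionCategory T (T ⧸ H)) := ⟨objEquiv T (T ⧸ H) ↑(1 : T)⟩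
    zigzag_isConnected fun x y => Relation.ReflTransGen.single <|
      Or.inl <| nonempty_subtype.mpr (show _ from MulAction.exists_smul_eq T x.back y.back)
  have := IsFreeGroupoid.endIsFreeOfConnectedFree (objEquiv T (T ⧸ H) ↑(1 : T))
  let e := endMulEquivSubgroup H
  -- The same map, restated for the multiplication coming from the groupoid structure.
  let e' : @MulEquiv (@End _ Groupoid.toCategory.toCategoryStruct (objEquiv T (T ⧸ H) ↑(1 : T))) H
      Group.toDivInvMonoid.toMulOneClass.toMul H.toGroup.toMulOneClass.toMul :=
    { toEquiv := e.toEquiv, map_mul' := fun a b => e.map_mul' a b }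
  exact IsFreeGroup.ofMulEquiv e'

open Monoid in
/-- A special case of the Kurosh subgroup theorem. -/
theorem Subgroup.isFreeGroup_of_coprodI {ι : Type u} {G : ι → Type v} [∀ i, Group (G i)]
    (H : Subgroup (CoprodI G))
    (hH : ∀ i, IsFreeGroup (G i) ∨ ∀ (g : G i) (t : CoprodI G),
      t⁻¹ * CoprodI.of g * t ∈ H → g = 1) : IsFreeGroup H := by
  let _ : ∀ i, MulAction (G i) (CoprodI G ⧸ H) := fun i => MulAction.compHom _ CoprodI.of
  have ⟨h⟩ := nonempty_isFreeGroupoid_actionCategory (G := G) (X := CoprodI G ⧸ H)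
    (fun _ _ _ => rfl) (fun i => ?_)
  · exact H.isFreeGroup_of_isFreeGroupoid
  · rcases hH i with h | h
    · exact IsActionBasis.of_isFreeGroup
    · refine IsActionBasis.of_free fun g x hx => ?_
      induction x using QuotientGroup.induction_on with
      | H t =>
        refine h g t ?_
        rw [mul_assoc, ← QuotientGroup.eq]
        exact hx.symm

/-! ### Normalizer of a point stabilizer -/

/-- If the points with the same stabilizer as `x 1` are the `x γ`, and `Γ` acts on them by right
multiplication, then `Γ` is the quotient of the normalizer of the stabilizer. -/
theorem nonempty_normalizer_stabilizer_quotient_mulEquiv {T X Γ : Type*} [Group T] [MulAction T X]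
    [Group Γ] (x : Γ → X) (hx : Function.Injective x)
    (htrans : ∀ γ, ∃ t : T, t • x 1 = x γ)
    (hright : ∀ δ, ∃ r : X → X, (∀ (t : T) y, r (t • y) = t • r y) ∧ ∀ γ, r (x γ) = x (γ * δ))
    (hfix : ∀ y, (∀ t ∈ MulAction.stabilizer T (x 1), t • y = y) → ∃ γ, x γ = y) :
    Nonempty ((↥(Subgroup.normalizer (MulAction.stabilizer T (x 1) : Set T)) ⧸
      (MulAction.stabilizer T (x 1)).subgroupOf
        (Subgroup.normalizer (MulAction.stabilizer T (x 1) : Set T))) ≃* Γ) := by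
  set H := MulAction.stabilizer T (x 1) with hH
  have hmem : ∀ {t : T}, t ∈ H ↔ t • x 1 = x 1 := MulAction.mem_stabilizer_iff
  -- The map `r` commutes with `T`, so what `t` does to `x 1` determines what it does to every `x
  -- δ`.
  have hequiv : ∀ (t : T) (γ δ : Γ), t • x 1 = x γ → t • x δ = x (γ * δ) := fun t γ δ h => by
    obtain ⟨r, h1, h2⟩ := hright δ
    rw [← h2, ← h, h1, h2, one_mul]
  have hnorm : ∀ n ∈ Subgroup.normalizer (H : Set T), ∃ γ, x γ = n • x 1 := fun n hn => by
    refine hfix _ fun t ht => ?_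
    have h := (Subgroup.mem_normalizer_iff''.mp hn t).mp ht
    rw [hmem, mul_smul, mul_smul, inv_smul_eq_iff] at h
    exact h
  choose q hq using fun n : Subgroup.normalizer (H : Set T) => hnorm n n.2
  let φ : Subgroup.normalizer (H : Set T) →* Γ := MonoidHom.mk' q fun m n => hx <| by
    rw [hq, Subgroup.coe_mul, mul_smul, ← hq n]
    exact hequiv _ _ _ (hq m).symm
  have hker : φ.ker = H.subgroupOf (Subgroup.normalizer (H : Set T)) := by
    ext n
    rw [MonoidHom.mem_ker, Subgroup.mem_subgroupOf, hmem, ← hq n, hx.eq_iff]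
    rfl
  have hsurj : Function.Surjective φ := fun γ => by
    obtain ⟨t, ht⟩ := htrans γ
    have hN : t ∈ Subgroup.normalizer (H : Set T) := by
      refine Subgroup.mem_normalizer_iff''.mpr fun h => ?_
      rw [hmem, hmem, mul_smul, mul_smul, inv_smul_eq_iff, ht]
      refine ⟨fun h1 => by simpa using hequiv _ _ γ (h1.trans rfl), fun h1 => ?_⟩
      obtain ⟨r, h2, h3⟩ := hright γ⁻¹
      have := congrArg r h1
      rwa [h2, h3, mul_inv_cancel] at this
    exact ⟨⟨t, hN⟩, hx ((hq _).trans ht)⟩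
  exact ⟨(QuotientGroup.quotientMulEquivOfEq hker.symm).trans
    (QuotientGroup.quotientKerEquivOfSurjective φ hsurj)⟩

/-! ### The finite set with prescribed symmetries -/

section

variable {P Q Γ : Type*} [Group P] [Group Q] [Group Γ] {n : ℕ}

/-- Right multiplication on the last factor. -/
def mulRightLast (δ : Γ) (x : P × Q × ZMod n × Γ) : P × Q × ZMod n × Γ :=
  (x.1, x.2.1, x.2.2.1, x.2.2.2 * δ)

/-- Left multiplication on the first factor. -/
def smulFst : P →* Equiv.Perm (P × Q × ZMod n × Γ) where
  toFun p := ⟨fun x => (p * x.1, x.2), fun x => (p⁻¹ * x.1, x.2), fun x => by simp,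
    fun x => by simp⟩
  map_one' := by ext1 x; simp
  map_mul' p q := by ext1 x; simp [mul_assoc]

/-- Left multiplication on the second factor. -/
def smulSnd : Q →* Equiv.Perm (P × Q × ZMod n × Γ) where
  toFun q := ⟨fun x => (x.1, q * x.2.1, x.2.2), fun x => (x.1, q⁻¹ * x.2.1, x.2.2),
    fun x => by simp, fun x => by simp⟩
  map_one' := by ext1 x; simp
  map_mul' p q := by ext1 x; simp [mul_assoc]

/-- The permutation that links the grids `P × Q × {s} × {γ}` to each other. -/
theorem exists_linking_perm {α : P} (hα : α * α ≠ 1) {β : Q} (hβ : β ≠ 1) (z : ZMod n → Γ) :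
    ∃ φ : Equiv.Perm (P × Q × ZMod n × Γ),
      (∀ s γ, φ (α, 1, s, γ) = if s + 1 = 0 then (1, β, 0, γ) else (α, 1, s + 1, γ)) ∧
      (∀ γ, φ (1, β, 0, γ) = (α, 1, 0, γ)) ∧
      (∀ s γ, φ (α⁻¹, β, s, γ) = (α⁻¹, β, s, z s * γ)) ∧
      (∀ a b s γ, ¬ (a = α ∧ b = 1) → ¬ (a = 1 ∧ b = β ∧ s = 0) → ¬ (a = α⁻¹ ∧ b = β) →
        φ (a, b, s, γ) = (a, b, s, γ)) ∧
      ∀ δ x, φ (mulRightLast δ x) = mulRightLast δ (φ x) := by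
  classical
  have h1 : α ≠ 1 := fun h => hα (by rw [h, mul_one])
  have h2 : α⁻¹ ≠ 1 := inv_ne_one.mpr h1
  have h3 : α⁻¹ ≠ α := fun h => hα (by nth_rw 1 [← h]; exact inv_mul_cancel α)
  -- `C` cycles the layers over the cell `(α, 1)`, `W` swaps the cells `(1, β)` and `(α, 1)` in
  -- layer 0, and `V` twists the `Γ`-coordinate by `z` over `(α⁻¹, β)`.
  let C : Equiv.Perm (P × Q × ZMod n × Γ) :=
    { toFun := fun x => (x.1, x.2.1, if x.1 = α ∧ x.2.1 = 1 then x.2.2.1 + 1 else x.2.2.1, x.2.2.2)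
      invFun := fun x =>
        (x.1, x.2.1, if x.1 = α ∧ x.2.1 = 1 then x.2.2.1 - 1 else x.2.2.1, x.2.2.2)
      left_inv := fun ⟨a, b, s, γ⟩ => by by_cases h : a = α ∧ b = 1 <;> simp [h]
      right_inv := fun ⟨a, b, s, γ⟩ => by by_cases h : a = α ∧ b = 1 <;> simp [h] }
  let W : Equiv.Perm (P × Q × ZMod n × Γ) :=
    (Equiv.prodAssoc P Q _).symm.trans ((Equiv.prodAssoc (P × Q) (ZMod n) Γ).symm.trans
      (((Equiv.swap ((1, β), 0) ((α, 1), 0)).prodCongr (Equiv.refl Γ)).trans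
        ((Equiv.prodAssoc (P × Q) (ZMod n) Γ).trans (Equiv.prodAssoc P Q _))))
  have hW : ∀ a b s γ, W (a, b, s, γ) =
      ((Equiv.swap ((1, β), (0 : ZMod n)) ((α, 1), 0) ((a, b), s)).1.1,
        (Equiv.swap ((1, β), (0 : ZMod n)) ((α, 1), 0) ((a, b), s)).1.2,
        (Equiv.swap ((1, β), (0 : ZMod n)) ((α, 1), 0) ((a, b), s)).2, γ) := fun _ _ _ _ => rfl
  let V : Equiv.Perm (P × Q × ZMod n × Γ) :=
    { toFun := fun x => (x.1, x.2.1, x.2.2.1,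
        if x.1 = α⁻¹ ∧ x.2.1 = β then z x.2.2.1 * x.2.2.2 else x.2.2.2)
      invFun := fun x => (x.1, x.2.1, x.2.2.1,
        if x.1 = α⁻¹ ∧ x.2.1 = β then (z x.2.2.1)⁻¹ * x.2.2.2 else x.2.2.2)
      left_inv := fun ⟨a, b, s, γ⟩ => by by_cases h : a = α⁻¹ ∧ b = β <;> simp [h]
      right_inv := fun ⟨a, b, s, γ⟩ => by by_cases h : a = α⁻¹ ∧ b = β <;> simp [h] }
  refine ⟨V * W * C, fun s γ => ?_, fun γ => ?_, fun s γ => ?_, fun a b s γ n1 n2 n3 => ?_,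
    fun δ ⟨a, b, s, γ⟩ => ?_⟩
  · have e : C (α, 1, s, γ) = (α, 1, s + 1, γ) := by simp [C]
    rw [Equiv.Perm.mul_apply, Equiv.Perm.mul_apply, e, hW]
    split_ifs with h
    · rw [h, Equiv.swap_apply_right]
      simp [V, h2.symm]
    · rw [Equiv.swap_apply_of_ne_of_ne (by simp [h]) (by simp [h])]
      simp [V, h3.symm]
  · have e : C (1, β, 0, γ) = (1, β, 0, γ) := by simp [C, hβ]
    rw [Equiv.Perm.mul_apply, Equiv.Perm.mul_apply, e, hW, Equiv.swap_apply_left]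
    simp [V, h3.symm]
  · have e : C (α⁻¹, β, s, γ) = (α⁻¹, β, s, γ) := by simp [C, hβ]
    rw [Equiv.Perm.mul_apply, Equiv.Perm.mul_apply, e, hW,
      Equiv.swap_apply_of_ne_of_ne (by simp [h1]) (by simp [hβ])]
    simp [V]
  · have e : C (a, b, s, γ) = (a, b, s, γ) := by simp [C, n1]
    rw [Equiv.Perm.mul_apply, Equiv.Perm.mul_apply, e, hW,
      Equiv.swap_apply_of_ne_of_ne (by simp only [ne_eq, Prod.mk.injEq]; tauto)
        (by simp only [ne_eq, Prod.mk.injEq]; tauto)]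
    simp [V, n3]
  · simp only [Equiv.Perm.mul_apply, mulRightLast]
    change V (W (_, _, _, γ * δ)) = _
    change _ = mulRightLast δ (V (W (_, _, _, γ)))
    rw [hW, hW]
    simp only [V, mulRightLast, Equiv.coe_fn_mk]
    split_ifs <;> simp [mul_assoc]

/-- Away from a few cells `φ` preserves the first two coordinates, so there `ρ α` and `σ β` disagree
in the second. The swap in layer 0 creates the wanted coincidences, the layer cycle links the
layers, and the twists `z s` link the `Γ`-coordinates. -/
theorem exists_equivariant_action [Finite P] [Finite Q] [Finite Γ] {α : P} (hα : α * α ≠ 1)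
    {β : Q} (hβ : β ≠ 1) :
    ∃ (n : ℕ) (_ : NeZero n) (ρ : P →* Equiv.Perm (P × Q × ZMod n × Γ))
      (σ : Q →* Equiv.Perm (P × Q × ZMod n × Γ)) (x : Γ → P × Q × ZMod n × Γ),
      Function.Injective x ∧
      (∀ p y, ρ p y = y → p = 1) ∧ (∀ q y, σ q y = y → q = 1) ∧
      (∀ δ, ∃ r : P × Q × ZMod n × Γ → P × Q × ZMod n × Γ, (∀ p y, r (ρ p y) = ρ p (r y)) ∧
        (∀ q y, r (σ q y) = σ q (r y)) ∧ ∀ γ, r (x γ) = x (γ * δ)) ∧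
      (∀ y, ρ α y = σ β y ↔ ∃ γ, x γ = y) ∧
      ∀ y, ∃ g ∈ ρ.range ⊔ σ.range, g (x 1) = y := by
  have h1 : α ≠ 1 := fun h => hα (by rw [h, mul_one])
  have h2 : α⁻¹ ≠ 1 := inv_ne_one.mpr h1
  have h3 : α⁻¹ ≠ α := fun h => hα (by nth_rw 1 [← h]; exact inv_mul_cancel α)
  -- Taking `n = 2|Γ|` leaves room for a surjection onto `Γ` and ensures `n ≥ 2`, even for trivial
  -- `Γ`.
  obtain ⟨n, hn0, hn, z, hz0, hz⟩ : ∃ (n : ℕ) (_ : NeZero n), (1 : ZMod n) ≠ 0 ∧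
      ∃ z : ZMod n → Γ, z 0 = 1 ∧ Function.Surjective z := by
    have hpos : 0 < Nat.card Γ := Nat.card_pos
    have hlt : 1 < Nat.card (Γ × Bool) := by simp; omega
    have : NeZero (Nat.card (Γ × Bool)) := ⟨by omega⟩
    have : Fact (1 < Nat.card (Γ × Bool)) := ⟨hlt⟩
    obtain ⟨e⟩ : Nonempty (ZMod (Nat.card (Γ × Bool)) ≃ Γ × Bool) :=
      Finite.card_eq.mp (by rw [Nat.card_zmod])
    refine ⟨_, inferInstance, one_ne_zero, fun s => (e s).1 * (e 0).1⁻¹, by simp, fun γ => ?_⟩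
    exact ⟨e.symm (γ * (e 0).1, true), by simp⟩
  obtain ⟨φ, φα, φu, φv, φo, φr⟩ := exists_linking_perm (n := n) hα hβ z
  let L : Q →* Equiv.Perm (P × Q × ZMod n × Γ) := smulSnd
  have hL : ∀ q a b s γ, L q (a, b, s, γ) = (a, q * b, s, γ) := fun _ _ _ _ _ => rfl
  let ρ : P →* Equiv.Perm (P × Q × ZMod n × Γ) := smulFst
  have hρ : ∀ p a b s γ, ρ p (a, b, s, γ) = (p * a, b, s, γ) := fun _ _ _ _ _ => rfl
  let σ : Q →* Equiv.Perm (P × Q × ZMod n × Γ) := (MulAut.conj φ).toMonoidHom.comp L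
  have hσ : ∀ q y, σ q (φ y) = φ (L q y) := fun q y => by simp [σ]
  have φone : ∀ s γ, φ (1, 1, s, γ) = (1, 1, s, γ) := fun s γ =>
    φo _ _ _ _ (by simp [h1.symm]) (by simp [hβ.symm]) (by simp [h2.symm])
  have φαβ : ∀ b s γ, b ≠ 1 → φ (α, b, s, γ) = (α, b, s, γ) := fun b s γ hb =>
    φo _ _ _ _ (by simp [hb]) (by simp [h1]) (by simp [h3.symm])
  refine ⟨n, hn0, ρ, σ, fun γ => (1, 1, 0, γ), fun γ δ h => by simpa using h, ?_, ?_, fun δ => ?_,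
    fun y => ⟨?_, ?_⟩, ?_⟩
  · rintro p ⟨a, b, s, γ⟩ h
    simpa [hρ] using h
  · intro q y h
    obtain ⟨⟨a, b, s, γ⟩, rfl⟩ := φ.surjective y
    rw [hσ, φ.apply_eq_iff_eq, hL] at h
    simpa using h
  · refine ⟨mulRightLast δ, fun _ _ => rfl, fun q y => ?_, fun _ => rfl⟩
    obtain ⟨y, rfl⟩ := φ.surjective y
    rw [← φr, hσ, hσ, ← φr]
    rfl
  · obtain ⟨⟨a, b, s, γ⟩, rfl⟩ := φ.surjective y
    rw [hσ, hL]
    have hs : s + 1 ≠ s := fun h => hn (by simpa using h)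
    by_cases c1 : a = α ∧ b = 1
    · obtain ⟨rfl, rfl⟩ := c1
      rw [φα, mul_one, φαβ _ _ _ hβ]
      split_ifs with h
      · rw [hρ]
        intro e
        simp only [Prod.mk.injEq] at e
        rw [← e.2.2.1, zero_add] at h
        exact absurd h hn
      · rw [hρ]
        intro e
        simp only [Prod.mk.injEq] at e
        exact absurd e.2.2.1 hs
    by_cases c2 : a = α ∧ β * b = 1
    · obtain ⟨rfl, c2⟩ := c2
      have hb : b ≠ 1 := fun h => c1 ⟨rfl, h⟩
      rw [c2, φα, φαβ _ _ _ hb, hρ]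
      split_ifs with h
      · intro e
        simp only [Prod.mk.injEq] at e
        rw [e.2.2.1, zero_add] at h
        exact absurd h hn
      · intro e
        simp only [Prod.mk.injEq] at e
        exact absurd e.2.2.1.symm hs
    by_cases c3 : a = 1 ∧ b = β ∧ s = 0
    · obtain ⟨rfl, rfl, rfl⟩ := c3
      rw [φu, hρ, φo _ _ _ _ (by simp [h1.symm]) (by simpa using hβ) (by simp [h2.symm])]
      intro e
      simp only [Prod.mk.injEq] at e
      exact absurd e.1 hα
    have fst_snd : ∀ b, ¬ (a = α ∧ b = 1) → ¬ (a = 1 ∧ b = β ∧ s = 0) →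
        (φ (a, b, s, γ)).1 = a ∧ (φ (a, b, s, γ)).2.1 = b := fun b k1 k2 => by
      by_cases k3 : a = α⁻¹ ∧ b = β
      · obtain ⟨rfl, rfl⟩ := k3
        rw [φv]
        exact ⟨rfl, rfl⟩
      · rw [φo _ _ _ _ k1 k2 k3]
        exact ⟨rfl, rfl⟩
    by_cases c4 : a = 1 ∧ b = 1 ∧ s = 0
    · obtain ⟨rfl, rfl, rfl⟩ := c4
      exact fun _ => ⟨γ, (φone _ _).symm⟩
    -- Here `φ` preserves the second coordinate on both sides, so equality would force `b = β * b`.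
    · intro e
      have e1 := fst_snd b c1 c3
      have e2 := fst_snd (β * b) c2 (fun h => c4 ⟨h.1, by simpa using h.2.1, h.2.2⟩)
      rw [← e] at e2
      exact absurd (e1.2.symm.trans e2.2) (by simpa using hβ)
  · rintro ⟨γ, rfl⟩
    change ρ α (1, 1, 0, γ) = σ β (1, 1, 0, γ)
    rw [← φone, hσ, hL, φone, mul_one, φu, hρ, mul_one]
  · set K := ρ.range ⊔ σ.range
    let R : P × Q × ZMod n × Γ → P × Q × ZMod n × Γ → Prop := fun y y' => ∃ g ∈ K, g y = y'
    have symm : ∀ {y y'}, R y y' → R y' y := by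
      rintro y _ ⟨g, hg, rfl⟩
      exact ⟨g⁻¹, K.inv_mem hg, by simp⟩
    have trans : ∀ {y y' y''}, R y y' → R y' y'' → R y y'' := by
      rintro y _ _ ⟨g, hg, rfl⟩ ⟨h, hh, rfl⟩
      exact ⟨h * g, K.mul_mem hh hg, rfl⟩
    have hP : ∀ a a' b s γ, R (a, b, s, γ) (a', b, s, γ) := fun a a' b s γ =>
      ⟨ρ (a' * a⁻¹), Subgroup.mem_sup_left ⟨_, rfl⟩, by rw [hρ, inv_mul_cancel_right]⟩
    have hQ : ∀ a b b' s γ, R (φ (a, b, s, γ)) (φ (a, b', s, γ)) := fun a b b' s γ =>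
      ⟨σ (b' * b⁻¹), Subgroup.mem_sup_right ⟨_, rfl⟩, by
        rw [hσ, hL, inv_mul_cancel_right]⟩
    -- Route through the column `a = α⁻¹`, which picks up the twist. `hcol` gives an untwisted
    -- route: through `a = 1` when `s ≠ 0`, and through `α⁻¹` when `s = 0`, since `z 0 = 1`.
    have hvolt : ∀ s γ, R (1, 1, s, γ) (1, β, s, z s * γ) := fun s γ => by
      have := hQ α⁻¹ 1 β s γ
      rw [φv, φo _ _ _ _ (by simp [h3]) (by simp [h2]) (by simp [hβ.symm])] at this
      exact trans (trans (hP _ _ _ _ _) this) (hP _ _ _ _ _)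
    have hcol : ∀ s γ, R (1, 1, s, γ) (1, β, s, γ) := fun s γ => by
      by_cases hs : s = 0
      · have := hvolt s γ
        rwa [hs, hz0, one_mul, ← hs] at this
      · have := hQ 1 1 β s γ
        rwa [φone, φo _ _ _ _ (by simp [h1.symm]) (by simp [hs]) (by simp [h2.symm])] at this
    have hz1 : ∀ s γ, R (1, 1, s, γ) (1, 1, s, z s * γ) := fun s γ =>
      trans (hvolt s γ) (symm (hcol _ _))
    have hb : ∀ b s γ, R (1, 1, s, γ) (1, b, s, γ) := fun b s γ => by
      by_cases hb : b = β
      · rw [hb]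
        exact hcol s γ
      · have := hQ α⁻¹ 1 b s γ
        rw [φo _ _ _ _ (by simp [h3]) (by simp [h2]) (by simp [hβ.symm]),
          φo _ _ _ _ (by simp [h3]) (by simp [h2]) (by simp [hb])] at this
        exact trans (trans (hP _ _ _ _ _) this) (hP _ _ _ _ _)
    -- The `Q`-orbit of `(α, β, s, γ)` contains `φ (α, 1, s, γ)`, which lies in layer `s + 1`
    -- whether or not the cycle closes up.
    have hstep : ∀ s γ, R (1, 1, s, γ) (1, 1, s + 1, γ) := fun s γ => by
      have := hQ α β 1 s γ
      rw [φαβ _ _ _ hβ, φα] at this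
      refine trans (trans (hcol s γ) (hP _ α _ _ _)) (trans this ?_)
      split_ifs with h
      · rw [h]
        exact symm (hcol _ _)
      · exact hP _ _ _ _ _
    have hall : ∀ s γ, R (1, 1, 0, γ) (1, 1, s, γ) := fun s γ => by
      obtain ⟨k, rfl⟩ := ZMod.natCast_zmod_surjective s
      induction k with
      | zero => rw [Nat.cast_zero]; exact ⟨1, K.one_mem, rfl⟩
      | succ k ih =>
        rw [Nat.cast_succ]
        exact trans ih (hstep _ _)
    rintro ⟨a, b, s, γ⟩
    obtain ⟨s', rfl⟩ := hz γ
    have h4 : R (1, 1, 0, 1) (1, 1, 0, z s') := by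
      have := trans (hall s' 1) (trans (hz1 s' 1) (symm (hall s' _)))
      rwa [mul_one] at this
    exact trans h4 (trans (trans (hall s _) (hb b _ _)) (hP _ _ _ _ _))

end

/-! ### Groups generated by two involutions -/

section

variable {T : Type*} [Group T] {a b : T}

theorem involution_mul_zpow_mul (ha : a * a = 1) (hb : b * b = 1) (k : ℤ) :
    a * (a * b) ^ k = (a * b) ^ (-k) * a := by
  have ha' : a⁻¹ = a := inv_eq_of_mul_eq_one_left ha
  have h : a * (a * b) * a⁻¹ = (a * b)⁻¹ := by
    rw [mul_inv_rev, ha', inv_eq_of_mul_eq_one_left hb, ← mul_assoc, ha, one_mul]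
  have := conj_zpow (i := k) (a := a) (b := a * b)
  rw [h, inv_zpow'] at this
  rw [this, inv_mul_cancel_right]

theorem exists_zpow_mul_of_closure_pair (ha : a * a = 1) (hb : b * b = 1)
    (h : Subgroup.closure {a, b} = ⊤) (x : T) :
    (∃ k : ℤ, x = (a * b) ^ k) ∨ ∃ k : ℤ, x = (a * b) ^ k * a := by
  have hx : x ∈ Subgroup.closure {a, b} := h ▸ Subgroup.mem_top x
  have hconj := involution_mul_zpow_mul ha hb
  have hr : (a * b) ^ (-1 : ℤ) = b * a := by
    rw [zpow_neg_one, mul_inv_rev, inv_eq_of_mul_eq_one_left ha, inv_eq_of_mul_eq_one_left hb]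
  induction hx using Subgroup.closure_induction with
  | mem x hx =>
    rcases hx with rfl | rfl
    · exact Or.inr ⟨0, by simp⟩
    · exact Or.inr ⟨-1, by rw [hr, mul_assoc, ha, mul_one]⟩
  | one => exact Or.inl ⟨0, by simp⟩
  | mul x y _ _ hx hy =>
    rcases hx with ⟨k, rfl⟩ | ⟨k, rfl⟩ <;> rcases hy with ⟨l, rfl⟩ | ⟨l, rfl⟩
    · exact Or.inl ⟨k + l, by rw [zpow_add]⟩
    · exact Or.inr ⟨k + l, by rw [zpow_add, mul_assoc]⟩
    · exact Or.inr ⟨k + -l, by rw [mul_assoc, hconj, zpow_add, mul_assoc]⟩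
    · refine Or.inl ⟨k + -l, ?_⟩
      rw [mul_assoc, ← mul_assoc a, hconj, mul_assoc, ha, mul_one, zpow_add]
  | inv x _ hx =>
    rcases hx with ⟨k, rfl⟩ | ⟨k, rfl⟩
    · exact Or.inl ⟨-k, by rw [zpow_neg]⟩
    · refine Or.inr ⟨k, inv_eq_of_mul_eq_one_left ?_⟩
      rw [mul_assoc, ← mul_assoc a, hconj, mul_assoc, ha, mul_one, ← zpow_add, add_neg_cancel,
        zpow_zero]

/-- A quotient of a normalizer modulo the subgroup, in a group generated by two involutions,
cannot have order 3. -/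
theorem not_isTelescopic_of_closure_pair (ha : a * a = 1) (hb : b * b = 1)
    (h : Subgroup.closure {a, b} = ⊤) : ¬ IsTelescopic.{w} T := by
  intro hT
  obtain ⟨H, -, ⟨e⟩⟩ := hT (ULift.{w} (Multiplicative (ZMod 3)))
  have hcub : ∀ z : ULift.{w} (Multiplicative (ZMod 3)), z * z = 1 → z = 1 := by
    rintro ⟨z⟩ hz
    have hz' : z * z = 1 := congrArg ULift.down hz
    have : ∀ z : Multiplicative (ZMod 3), z * z = 1 → z = 1 := by decide
    exact congrArg ULift.up (this z hz')
  let q : ↥(Subgroup.normalizer (H : Set T)) →* ULift.{w} (Multiplicative (ZMod 3)) :=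
    e.toMonoidHom.comp (QuotientGroup.mk' _)
  have hq : ∀ n, q n = 1 ↔ (n : T) ∈ H := fun n => by
    change e (QuotientGroup.mk n) = 1 ↔ _
    rw [map_eq_one_iff e e.injective, QuotientGroup.eq_one_iff, Subgroup.mem_subgroupOf]
  have hsurj : Function.Surjective q :=
    e.surjective.comp (QuotientGroup.mk'_surjective _)
  have hconj := involution_mul_zpow_mul ha hb
  have hgen := exists_zpow_mul_of_closure_pair ha hb h
  have hrefl : ∀ k : ℤ, ((a * b) ^ k * a) * ((a * b) ^ k * a) = 1 := fun k => by
    rw [mul_assoc, ← mul_assoc a, hconj, mul_assoc, ha, mul_one, ← zpow_add, add_neg_cancel,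
      zpow_zero]
  suffices ∀ n, q n = 1 by
    obtain ⟨n, hn⟩ := hsurj ⟨Multiplicative.ofAdd 1⟩
    rw [this n] at hn
    exact absurd (congrArg ULift.down hn) (by decide)
  -- If `H` contains a reflection `t`, a rotation `n` in the normalizer satisfies `n * t * n = t`,
  -- so its image has square 1, as do images of reflections. Otherwise `H` consists of rotations and
  -- is normal.
  by_cases hH : ∃ k : ℤ, (a * b) ^ k * a ∈ H
  · obtain ⟨k, hk⟩ := hH
    intro n
    refine hcub _ ?_
    rcases hgen n with ⟨l, hl⟩ | ⟨l, hl⟩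
    · let t : ↥(Subgroup.normalizer (H : Set T)) := ⟨_, Subgroup.le_normalizer hk⟩
      have ht : q t = 1 := (hq t).mpr hk
      have h1 : n * t * n = t := by
        ext
        change (n : T) * ((a * b) ^ k * a) * n = (a * b) ^ k * a
        rw [hl, mul_assoc, mul_assoc _ a, hconj, ← mul_assoc, ← mul_assoc, ← zpow_add,
          ← zpow_add]
        congr 2
        ring
      have h2 := congrArg q h1
      rwa [map_mul, map_mul, ht, mul_one] at h2
    · rw [← map_mul, ← map_one q]
      congr 1
      ext
      rw [Subgroup.coe_mul, hl, hrefl, Subgroup.coe_one]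
  · have hrot : ∀ x ∈ H, ∃ k : ℤ, x = (a * b) ^ k := fun x hx =>
      (hgen x).resolve_right fun ⟨k, hk⟩ => hH ⟨k, hk ▸ hx⟩
    have hnorm : H.Normal := by
      refine ⟨fun x hx g => ?_⟩
      obtain ⟨k, rfl⟩ := hrot x hx
      rcases hgen g with ⟨l, rfl⟩ | ⟨l, rfl⟩
      · rwa [← zpow_add, add_comm, zpow_add, mul_inv_cancel_right]
      · have : (a * b) ^ l * a * (a * b) ^ k * ((a * b) ^ l * a)⁻¹ = ((a * b) ^ k)⁻¹ := by
          rw [mul_inv_eq_iff_eq_mul, mul_assoc, hconj, ← mul_assoc, ← mul_assoc, ← zpow_add,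
            ← zpow_neg, ← zpow_add, add_comm]
        rw [this]
        exact H.inv_mem hx
    have htop : ∀ x, x ∈ Subgroup.normalizer (H : Set T) := fun x =>
      Subgroup.normalizer_eq_top (H := H) ▸ Subgroup.mem_top x
    intro n
    have hinv : ∀ c (hc : c * c = 1), q ⟨c, htop c⟩ = 1 := fun c hc => by
      refine hcub _ ?_
      rw [← map_mul, ← map_one q]
      congr 1
      ext
      exact hc
    have key : ∀ x ∈ Subgroup.closure {a, b}, q ⟨x, htop x⟩ = 1 := fun x hx => by
      induction hx using Subgroup.closure_induction with
      | mem x hx =>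
        rcases hx with rfl | rfl
        · exact hinv _ ha
        · exact hinv _ hb
      | one => exact map_one q
      | mul x y _ _ hx hy =>
        have : q (⟨x, htop x⟩ * ⟨y, htop y⟩) = 1 := by rw [map_mul, hx, hy, mul_one]
        exact this
      | inv x _ hx =>
        have : q (⟨x, htop x⟩⁻¹) = 1 := by rw [map_inv, hx, inv_one]
        exact this
    exact key n (h ▸ Subgroup.mem_top _)

end

open Monoid in
theorem not_isTelescopic_coprodI_zmod_two :
    ¬ IsTelescopic.{w, 0} (CoprodI (fun _ : Fin 2 => Multiplicative (ZMod 2))) := by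
  let c : Fin 2 → CoprodI (fun _ : Fin 2 => Multiplicative (ZMod 2)) := fun i =>
    CoprodI.of (i := i) (Multiplicative.ofAdd 1)
  have hc : ∀ i, c i * c i = 1 := fun i => by
    rw [← map_mul]
    exact map_one CoprodI.of
  refine not_isTelescopic_of_closure_pair (hc 0) (hc 1) (top_le_iff.mp ?_)
  have hmem : ∀ i, c i ∈ Subgroup.closure {c 0, c 1} := by
    intro i
    refine Subgroup.subset_closure ?_
    fin_cases i <;> simp
  intro x _
  induction x using CoprodI.induction_on with
  | one => exact Subgroup.one_mem _
  | of i m =>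
    have key : ∀ m : Multiplicative (ZMod 2), m = 1 ∨ m = Multiplicative.ofAdd 1 := by decide
    rcases key m with rfl | rfl
    · rw [map_one]
      exact Subgroup.one_mem _
    · exact hmem i
  | mul x y hx hy => exact Subgroup.mul_mem _ (hx trivial) (hy trivial)

/-! ### Reduction to a free product of two finite groups -/

open Monoid

/-- A free product of groups is freely telescopic if it maps onto the free product of two finite
nontrivial groups, the first of which is not an elementary abelian 2-group, so that every factor which is not free is
embedded in one of the two groups. -/
theorem isFreelyTelescopic_of_surjective_coprod {ι : Type u} {G : ι → Type v} [∀ i, Group (G i)]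
    {P Q : Type*} [Group P] [Group Q] [Finite P] [Finite Q] {α : P} (hα : α * α ≠ 1)
    {β : Q} (hβ : β ≠ 1) (Ψ : CoprodI G →* Coprod P Q) (hΨ : Function.Surjective Ψ)
    (hfree : ∀ i, IsFreeGroup (G i) ∨
      (∃ f : G i →* P, Function.Injective f ∧ ∀ g, Ψ (CoprodI.of g) = Coprod.inl (f g)) ∨
      ∃ f : G i →* Q, Function.Injective f ∧ ∀ g, Ψ (CoprodI.of g) = Coprod.inr (f g)) :
    IsFreelyTelescopic.{w} (CoprodI G) := by
  intro Γ _ _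
  obtain ⟨n, _, ρ, σ, x, hx, hρ, hσ, hright, hxw, htrans⟩ :=
    exists_equivariant_action (Γ := Γ) hα hβ
  let _ : MulAction (CoprodI G) (P × Q × ZMod n × Γ) :=
    MulAction.compHom _ ((Coprod.lift ρ σ).comp Ψ)
  have smul_def : ∀ (t : CoprodI G) y, t • y = Coprod.lift ρ σ (Ψ t) y := fun _ _ => rfl
  refine ⟨MulAction.stabilizer (CoprodI G) (x 1), ?_, ?_, ?_⟩
  · refine ⟨?_⟩
    rw [MulAction.index_stabilizer]
    exact Set.ncard_ne_zero_of_mem (MulAction.mem_orbit_self _) (Set.toFinite _)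
  · refine Subgroup.isFreeGroup_of_coprodI _ fun i => (hfree i).imp_right ?_
    rintro (⟨f, hf, hfi⟩ | ⟨f, hf, hfi⟩) g t ht
    · rw [MulAction.mem_stabilizer_iff, mul_smul, mul_smul, inv_smul_eq_iff, smul_def, hfi,
        Coprod.lift_apply_inl] at ht
      exact hf ((hρ _ _ ht).trans (map_one f).symm)
    · rw [MulAction.mem_stabilizer_iff, mul_smul, mul_smul, inv_smul_eq_iff, smul_def, hfi,
        Coprod.lift_apply_inr] at ht
      exact hf ((hσ _ _ ht).trans (map_one f).symm)
  · refine nonempty_normalizer_stabilizer_quotient_mulEquiv x hx (fun γ => ?_) (fun δ => ?_)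
      fun y hy => ?_
    · obtain ⟨g, hg, hgx⟩ := htrans (x γ)
      rw [← Coprod.range_lift] at hg
      obtain ⟨p, rfl⟩ := hg
      obtain ⟨t, rfl⟩ := hΨ p
      exact ⟨t, hgx⟩
    · obtain ⟨r, h1, h2, h3⟩ := hright δ
      refine ⟨r, fun t y => ?_, h3⟩
      simp only [smul_def]
      generalize Ψ t = p
      induction p using Coprod.induction_on generalizing y with
      | inl p => simpa using h1 p y
      | inr q => simpa using h2 q y
      | mul a b ha hb => simp [ha, hb]
    -- A lift of `β⁻¹α`: it lies in the stabilizer of `x 1` and fixes only the points `x γ`.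
    · obtain ⟨t, ht⟩ := hΨ ((Coprod.inr β)⁻¹ * Coprod.inl α)
      have key : ∀ y, t • y = y ↔ ρ α y = σ β y := fun y => by
        rw [smul_def, ht, map_mul, map_inv, Coprod.lift_apply_inl, Coprod.lift_apply_inr,
          Equiv.Perm.mul_apply, Equiv.Perm.inv_eq_iff_eq]
      refine (hxw y).mp ((key y).mp (hy t ?_))
      exact (key _).mpr ((hxw _).mpr ⟨1, rfl⟩)

/-- The factors of a free product are divided into two classes, each of which is mapped to a
finite group. -/
theorem isFreelyTelescopic_of_two_colouring {ι : Type u} {G : ι → Type v} [∀ i, Group (G i)]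
    {P Q : Type*} [Group P] [Group Q] [Finite P] [Finite Q] (c : ι → Prop)
    (f : ∀ i, G i →* P) (g : ∀ i, G i →* Q)
    (hf : ∀ i, c i → IsFreeGroup (G i) ∨ Function.Injective (f i))
    (hg : ∀ i, ¬ c i → IsFreeGroup (G i) ∨ Function.Injective (g i))
    {α : P} (hαmem : α ∈ ⨆ i, ⨆ _ : c i, (f i).range) (hα : α * α ≠ 1)
    {β : Q} (hβmem : β ∈ ⨆ i, ⨆ _ : ¬ c i, (g i).range) (hβ : β ≠ 1) :
    IsFreelyTelescopic.{w} (CoprodI G) := by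
  classical
  -- Cutting down to the subgroups generated by the images makes `Ψ` surjective.
  set P' := ⨆ i, ⨆ _ : c i, (f i).range
  set Q' := ⨆ i, ⨆ _ : ¬ c i, (g i).range
  have hf' : ∀ i, c i → ∀ x, f i x ∈ P' := fun i hi x =>
    (le_iSup₂ (f := fun i (_ : c i) => (f i).range) i hi) ⟨x, rfl⟩
  have hg' : ∀ i, ¬ c i → ∀ x, g i x ∈ Q' := fun i hi x =>
    (le_iSup₂ (f := fun i (_ : ¬ c i) => (g i).range) i hi) ⟨x, rfl⟩
  let Ψ : CoprodI G →* Coprod P' Q' := CoprodI.lift fun i =>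
    if h : c i then Coprod.inl.comp ((f i).codRestrict P' (hf' i h))
    else Coprod.inr.comp ((g i).codRestrict Q' (hg' i h))
  have hΨf : ∀ i (h : c i) x, Ψ (CoprodI.of x) = Coprod.inl ⟨f i x, hf' i h x⟩ := fun i h x => by
    simp only [Ψ, CoprodI.lift_of, dif_pos h]
    rfl
  have hΨg : ∀ i (h : ¬ c i) x, Ψ (CoprodI.of x) = Coprod.inr ⟨g i x, hg' i h x⟩ :=
    fun i h x => by
      simp only [Ψ, CoprodI.lift_of, dif_neg h]
      rfl
  have hP : P' ≤ (Ψ.range.comap Coprod.inl).map P'.subtype :=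
    iSup₂_le fun i hi => by
      rintro _ ⟨x, rfl⟩
      exact ⟨⟨f i x, hf' i hi x⟩, ⟨CoprodI.of x, hΨf i hi x⟩, rfl⟩
  have hQ : Q' ≤ (Ψ.range.comap Coprod.inr).map Q'.subtype :=
    iSup₂_le fun i hi => by
      rintro _ ⟨x, rfl⟩
      exact ⟨⟨g i x, hg' i hi x⟩, ⟨CoprodI.of x, hΨg i hi x⟩, rfl⟩
  have hsurj : Function.Surjective Ψ := by
    rw [← MonoidHom.range_eq_top, ← top_le_iff, ← Coprod.range_inl_sup_range_inr]
    refine sup_le ?_ ?_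
    · rintro _ ⟨p, rfl⟩
      obtain ⟨p', hp', h⟩ := hP p.2
      rwa [← Subtype.ext h]
    · rintro _ ⟨p, rfl⟩
      obtain ⟨p', hp', h⟩ := hQ p.2
      rwa [← Subtype.ext h]
  refine isFreelyTelescopic_of_surjective_coprod (α := (⟨α, hαmem⟩ : P')) (β := (⟨β, hβmem⟩ : Q'))
    (fun h => hα (congrArg Subtype.val h)) (fun h => hβ (congrArg Subtype.val h)) Ψ hsurj
    fun i => ?_
  by_cases h : c i
  · refine (hf i h).imp_right fun hinj => Or.inl ⟨(f i).codRestrict P' (hf' i h), ?_, hΨf i h⟩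
    exact fun x y hxy => hinj (congrArg Subtype.val hxy)
  · refine (hg i h).imp_right fun hinj => Or.inr ⟨(g i).codRestrict Q' (hg' i h), ?_, hΨg i h⟩
    exact fun x y hxy => hinj (congrArg Subtype.val hxy)

/-! ### Cyclic factors -/

/-- A nontrivial cyclic group maps onto a finite one; the map is an embedding unless the group is
infinite cyclic, hence free, and order 2 occurs only for groups of order 2. -/
theorem exists_surjective_zmod (G : Type*) [Group G] [IsCyclic G] [Nontrivial G] :
    ∃ (m : ℕ) (f : G →* Multiplicative (ZMod m)), 2 ≤ m ∧ Function.Surjective f ∧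
      (IsFreeGroup G ∨ Function.Injective f) ∧ (m = 2 → Nat.card G = 2) := by
  rcases finite_or_infinite G with hG | hG
  · have e := (zmodCyclicMulEquiv (G := G) inferInstance).symm
    exact ⟨Nat.card G, e.toMonoidHom, Finite.one_lt_card, e.surjective, Or.inr e.injective, id⟩
  · have e := (intCyclicMulEquiv (G := G)).symm
    refine ⟨3, (AddMonoidHom.toMultiplicative (Int.castAddHom (ZMod 3))).comp e.toMonoidHom,
      by norm_num, ?_, Or.inl ?_, by norm_num⟩
    · have h3 : Function.Surjective (AddMonoidHom.toMultiplicative (Int.castAddHom (ZMod 3))) :=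
        ZMod.intCast_surjective
      exact h3.comp e.surjective
    · exact IsFreeGroup.ofMulEquiv
        ((FreeGroup.mulEquivIntOfUnique (α := Unit)).trans e.symm)

theorem isFreelyTelescopic_coprodI_of_isCyclic (ι : Type u) [Finite ι] [Nontrivial ι]
    (G : ι → Type v) [∀ i, Group (G i)] [∀ i, IsCyclic (G i)] [∀ i, Nontrivial (G i)]
    (h : ¬ (Nat.card ι = 2 ∧ ∀ i, Nat.card (G i) = 2)) :
    IsFreelyTelescopic.{w, max u v} (CoprodI G) := by
  classical
  choose m f hm hsurj hfree hcard using fun i => exists_surjective_zmod (G i)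
  have : ∀ i, NeZero (m i) := fun i => ⟨by have := hm i; omega⟩
  -- If all factors have order 2 there are at least three: one is sent to `ZMod 2`, the rest to
  -- transpositions in `S₃`, both `(0 1)` and `(1 2)` occurring, so that `α` can be a 3-cycle.
  -- Otherwise a factor with `m i ≥ 3` is separated from the rest and supplies `α`.
  by_cases hall : ∀ i, m i = 2
  · have h3 : 2 < Nat.card ι := by
      have h1 : 1 < Nat.card ι := Finite.one_lt_card
      have h2 : Nat.card ι ≠ 2 := fun h2 => h ⟨h2, fun i => hcard i (hall i)⟩
      omega
    obtain ⟨i₀, i₁, hne⟩ := exists_pair_ne ι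
    obtain ⟨i₂, hi₂, hi₂'⟩ : ∃ i₂, i₂ ≠ i₀ ∧ i₂ ≠ i₁ := by
      by_contra! hcon
      have hsub : (Set.univ : Set ι) ⊆ {i₀, i₁} := fun i _ => by
        by_cases hi : i = i₀
        · exact Or.inl hi
        · exact Or.inr (hcon i hi)
      have hle := Set.ncard_le_ncard hsub (Set.toFinite _)
      rw [Set.ncard_univ, Set.ncard_pair hne] at hle
      omega
    let C := Multiplicative (ZMod 2)
    have e : ∀ i, ∃ e : G i →* C, Function.Surjective e ∧
        (IsFreeGroup (G i) ∨ Function.Injective e) := fun i => by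
      obtain ⟨e, he⟩ : ∃ e : Multiplicative (ZMod (m i)) ≃* C, True := by
        rw [hall i]
        exact ⟨MulEquiv.refl _, trivial⟩
      exact ⟨e.toMonoidHom.comp (f i), e.surjective.comp (hsurj i),
        (hfree i).imp_right e.injective.comp⟩
    choose e he he' using e
    have hhom : ∀ τ : Equiv.Perm (Fin 3), τ ≠ 1 → τ * τ = 1 →
        ∃ k : C →* Equiv.Perm (Fin 3), Function.Injective k ∧ k (Multiplicative.ofAdd 1) = τ := by
      intro τ hτ1 hτ
      have key : ∀ m : C, m = 1 ∨ m = Multiplicative.ofAdd 1 := by decide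
      have hne : (Multiplicative.ofAdd 1 : C) ≠ 1 := by decide
      have hmul : (Multiplicative.ofAdd 1 : C) * Multiplicative.ofAdd 1 = 1 := by decide
      refine ⟨MonoidHom.mk' (fun y => if y = 1 then 1 else τ) fun a b => ?_, fun a b => ?_, ?_⟩
      · rcases key a with rfl | rfl <;> rcases key b with rfl | rfl <;> simp [hne, hτ, hmul]
      · rcases key a with rfl | rfl <;> rcases key b with rfl | rfl <;> simp [hne, hτ1, hτ1.symm]
      · simp [hne]
    obtain ⟨k₁, hk₁, hk₁'⟩ := hhom (Equiv.swap 0 1) (by decide) (by decide)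
    obtain ⟨k₂, hk₂, hk₂'⟩ := hhom (Equiv.swap 1 2) (by decide) (by decide)
    refine isFreelyTelescopic_of_two_colouring (P := Equiv.Perm (Fin 3)) (Q := C) (fun i => i ≠ i₀)
      (fun i => (if i = i₁ then k₁ else k₂).comp (e i)) e (fun i _ => ?_) (fun i _ => he' i)
      (α := Equiv.swap 0 1 * Equiv.swap 1 2) (mul_mem ?_ ?_) (by decide)
      (β := Multiplicative.ofAdd 1) ?_ (by decide)
    · refine (he' i).imp_right fun hinj => ?_
      split_ifs
      exacts [hk₁.comp hinj, hk₂.comp hinj]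
    · obtain ⟨y, hy⟩ := he i₁ (Multiplicative.ofAdd 1)
      refine Subgroup.mem_iSup_of_mem i₁ (Subgroup.mem_iSup_of_mem hne.symm ⟨y, ?_⟩)
      simp [hy, hk₁']
    · obtain ⟨y, hy⟩ := he i₂ (Multiplicative.ofAdd 1)
      refine Subgroup.mem_iSup_of_mem i₂ (Subgroup.mem_iSup_of_mem hi₂ ⟨y, ?_⟩)
      simp [hy, hk₂', hi₂']
    · obtain ⟨y, hy⟩ := he i₀ (Multiplicative.ofAdd 1)
      exact Subgroup.mem_iSup_of_mem i₀ (Subgroup.mem_iSup_of_mem (not_not.mpr rfl) ⟨y, hy⟩)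
  · push Not at hall
    obtain ⟨i₀, hi₀⟩ := hall
    obtain ⟨i₁, hi₁⟩ := exists_ne i₀
    let F : ∀ i, G i →* (∀ j, Multiplicative (ZMod (m j))) := fun i =>
      (MonoidHom.mulSingle _ i).comp (f i)
    have hF : ∀ i, IsFreeGroup (G i) ∨ Function.Injective (F i) := fun i =>
      (hfree i).imp_right fun hinj => (Pi.mulSingle_injective i).comp hinj
    obtain ⟨a, ha⟩ := hsurj i₀ (Multiplicative.ofAdd 1)
    obtain ⟨b, hb⟩ := hsurj i₁ (Multiplicative.ofAdd 1)
    have hF0 : ∀ i y, F i y = 1 → f i y = 1 := fun i y hy =>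
      Pi.mulSingle_eq_one_iff.mp hy
    refine isFreelyTelescopic_of_two_colouring (fun i => i = i₀) F F (fun i _ => hF i)
      (fun i _ => hF i) (α := F i₀ a) (Subgroup.mem_iSup_of_mem i₀
        (Subgroup.mem_iSup_of_mem rfl ⟨a, rfl⟩)) (fun h1 => ?_) (β := F i₁ b)
      (Subgroup.mem_iSup_of_mem i₁ (Subgroup.mem_iSup_of_mem hi₁ ⟨b, rfl⟩)) fun h1 => ?_
    · rw [← map_mul] at h1
      have h2 := hF0 _ _ h1
      rw [map_mul, ha] at h2
      have h3 : ((2 : ℕ) : ZMod (m i₀)) = 0 := by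
        rw [Nat.cast_two, ← one_add_one_eq_two]
        exact congrArg Multiplicative.toAdd h2
      rw [ZMod.natCast_eq_zero_iff] at h3
      have := Nat.le_of_dvd two_pos h3
      have := hm i₀
      omega
    · have h2 := hF0 _ _ h1
      rw [hb] at h2
      have h3 : ((1 : ℕ) : ZMod (m i₁)) = 0 := by
        rw [Nat.cast_one]
        exact congrArg Multiplicative.toAdd h2
      rw [ZMod.natCast_eq_zero_iff] at h3
      have := Nat.le_of_dvd one_pos h3
      have := hm i₁
      omega

theorem theorem3 :
    (∀ (ι : Type u) [Finite ι] [Nontrivial ι] (G : ι → Type v) [∀ i, Group (G i)]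
      [∀ i, IsCyclic (G i)] [∀ i, Nontrivial (G i)],
      ¬ (Nat.card ι = 2 ∧ ∀ i, Nat.card (G i) = 2) →
        IsFreelyTelescopic.{w, max u v} (Monoid.CoprodI G)) ∧
    ¬ IsTelescopic.{w, 0} (Monoid.CoprodI (fun _ : Fin 2 => Multiplicative (ZMod 2))) :=
  ⟨isFreelyTelescopic_coprodI_of_isCyclic, not_isTelescopic_coprodI_zmod_two⟩
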